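/- Let $\mathbf a^1,\dots,\mathbf a^k\in\mathbb R^n$ be pairwise linearly independent vectors, and let $f:\mathbb R^n\to\mathbb R$ be a continuous function of the form $$f(\mathbf x)=\sum_{i=1}^k f_i(\mathbf a^i\cdot\mathbf x)\qquad(\mathbf x\in\mathbb R^n),$$ where $f_1,\dots,f_k:\mathbb R\to\mathbb R$ are arbitrary functions (no regularity is assumed). Assume that there is a nonsingular linear transformation $T:\mathbb R^n\to\mathbb R^n$ such that $T\mathbf a^i\in\mathbb Q^n$ for $i=1,\dots,k$. Then there exist continuous functions $g_1,\dots,g_k:\mathbb R\to\mathbb R$ such that $$f(\mathbf x)=\sum_{i=1}^k g_i(\mathbf a^i\cdot\mathbf x)\qquad\text{for all }\mathbf x\in\mathbb R^n.$$ -/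

import Mathlib

/-! A linear change of variables makes all directions rational, and everything is then restricted to
`ℚ`, where pathological additive functions do not exist. To isolate one `φ i`, take differences of
`f` along vectors orthogonal to each other direction in turn: iterated differences of `φ i` are
equicontinuous on bounded sets, uniformly over bounded steps (`exists_family_killing_ridges`). On
`ℚ` this regularity descends from differences to the function
(`EquiUniformOnBounded.of_iterate_diffSet`). So `φ i` on `ℚ` extends continuously to `ℝ`, and
density of `ℚ^n` gives the identity. -/

theorem norm_rat_eq_abs (q : ℚ) : ‖q‖ = |(q : ℝ)| := by
  rw [← Rat.norm_cast_real, Real.norm_eq_abs]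

/-- Uniform equicontinuity on bounded sets for a family of real functions. -/
def EquiUniformOnBounded {E : Type*} [SeminormedAddCommGroup E] (𝓕 : Set (E → ℝ)) : Prop :=
  ∀ R : ℝ, ∀ ε > 0, ∃ δ > 0, ∀ φ ∈ 𝓕, ∀ x y, ‖x‖ ≤ R → ‖y‖ ≤ R → ‖x - y‖ ≤ δ →
    |φ x - φ y| ≤ ε

/-- All first differences of members of `𝓕` with step at most `R`. -/
def diffSet (R : ℝ) (𝓕 : Set (ℚ → ℝ)) : Set (ℚ → ℝ) :=
  {ψ | ∃ φ ∈ 𝓕, ∃ h : ℚ, ‖h‖ ≤ R ∧ ψ = fun t => φ (t + h) - φ t}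

theorem EquiUniformOnBounded.mono {E : Type*} [SeminormedAddCommGroup E] {𝓕 𝓖 : Set (E → ℝ)}
    (h𝓖 : EquiUniformOnBounded 𝓖) (h : 𝓕 ⊆ 𝓖) : EquiUniformOnBounded 𝓕 := by
  intro R ε hε
  obtain ⟨δ, hδ, H⟩ := h𝓖 R ε hε
  exact ⟨δ, hδ, fun φ hφ => H φ (h hφ)⟩

theorem diffSet_mono {R R' : ℝ} (hR : R ≤ R') {𝓕 𝓖 : Set (ℚ → ℝ)} (h : 𝓕 ⊆ 𝓖) :
    diffSet R 𝓕 ⊆ diffSet R' 𝓖 := by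
  rintro _ ⟨φ, hφ, s, hs, rfl⟩
  exact ⟨φ, h hφ, s, hs.trans hR, rfl⟩

theorem iterate_diffSet_mono {R R' : ℝ} (hR : R ≤ R') (m : ℕ) {𝓕 𝓖 : Set (ℚ → ℝ)} (h : 𝓕 ⊆ 𝓖) :
    (diffSet R)^[m] 𝓕 ⊆ (diffSet R')^[m] 𝓖 := by
  induction m with
  | zero => exact h
  | succ m ih =>
    rw [Function.iterate_succ_apply', Function.iterate_succ_apply']
    exact diffSet_mono hR ih

theorem EquiUniformOnBounded.exists_bound {𝓕 : Set (ℚ → ℝ)} (h𝓕 : EquiUniformOnBounded 𝓕)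
    (R : ℝ) : ∃ C, 0 ≤ C ∧ ∀ φ ∈ 𝓕, ∀ x : ℚ, ‖x‖ ≤ R → |φ x - φ 0| ≤ C := by
  obtain ⟨δ, hδ, H⟩ := h𝓕 R 1 one_pos
  obtain ⟨N, hN⟩ := exists_nat_gt (R / δ)
  refine ⟨N, by positivity, fun φ hφ x hx => ?_⟩
  have hR : 0 ≤ R := (norm_nonneg x).trans hx
  have hN0 : (0 : ℝ) < N := lt_of_le_of_lt (by positivity) hN
  have hNq : (N : ℚ) ≠ 0 := by
    have : N ≠ 0 := by rintro rfl; simp at hN0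
    exact_mod_cast this
  have key : ∀ j : ℕ, j ≤ N → |φ (j / N * x) - φ 0| ≤ j := by
    intro j
    induction j with
    | zero => simp
    | succ j ih =>
      intro hj
      have h1 := ih (by omega)
      have hb : ∀ i : ℕ, i ≤ N → ‖((i : ℚ) / N * x : ℚ)‖ ≤ R := by
        intro i hi
        rw [norm_mul, norm_div]
        have e1 : ‖(i : ℚ)‖ = i := by simp [norm_rat_eq_abs]
        have e2 : ‖(N : ℚ)‖ = N := by simp [norm_rat_eq_abs]
        rw [e1, e2]
        have : (i : ℝ) / N ≤ 1 := (div_le_one hN0).2 (by exact_mod_cast hi)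
        nlinarith [norm_nonneg x]
      have h2 := H φ hφ _ _ (hb (j + 1) hj) (hb j (by omega)) (by
        have : ((j + 1 : ℕ) : ℚ) / N * x - (j : ℚ) / N * x = x / N := by
          push_cast; field_simp; ring
        rw [this, norm_div]
        have e2 : ‖(N : ℚ)‖ = N := by simp [norm_rat_eq_abs]
        rw [e2, div_le_iff₀ hN0]
        rw [div_lt_iff₀ hδ] at hN
        linarith)
      have := abs_sub_le (φ (((j + 1 : ℕ) : ℚ) / N * x)) (φ ((j : ℚ) / N * x)) (φ 0)
      push_cast at *
      linarith
  have := key N le_rfl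
  rwa [div_self hNq, one_mul] at this

/-! ### Recovering regularity of a family from its differences -/

/-- Doubling argument: an almost additive function on `ℚ` is bounded on bounded sets. -/
theorem exists_bound_of_diffSet {𝓕 : Set (ℚ → ℝ)}
    (hpb : ∀ r : ℚ, ∃ C, ∀ φ ∈ 𝓕, |φ r - φ 0| ≤ C)
    (hd : ∀ R, EquiUniformOnBounded (diffSet R 𝓕)) (R : ℕ) :
    ∃ C, 0 ≤ C ∧ ∀ φ ∈ 𝓕, ∀ x : ℚ, ‖x‖ ≤ R → |φ x - φ 0| ≤ C := by
  obtain ⟨C, hC, H⟩ := (hd R).exists_bound R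
  have hG : ∀ φ ∈ 𝓕, ∀ h x : ℚ, |h| ≤ R → |x| ≤ R →
      |(φ (x + h) - φ x) - (φ h - φ 0)| ≤ C := by
    intro φ hφ h x hh hx
    have hh' : ‖h‖ ≤ R := by rw [norm_rat_eq_abs]; exact_mod_cast hh
    have hx' : ‖x‖ ≤ R := by rw [norm_rat_eq_abs]; exact_mod_cast hx
    simpa using H _ ⟨φ, hφ, h, hh', rfl⟩ x hx'
  obtain ⟨A, hA⟩ := hpb (R / 2)
  obtain ⟨A', hA'⟩ := hpb (-(R / 2))
  have step : ∀ φ ∈ 𝓕, ∀ s x : ℚ, |s| ≤ R → |2 * x - 2 * s| ≤ R →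
      |φ x - φ 0| ≤ |φ (2 * x - 2 * s) - φ 0| / 2 + |φ s - φ 0| + 2 * C := by
    intro φ hφ s x hs hx
    have hy : |x - s| ≤ R := by
      rw [← mul_sub, abs_mul, abs_two] at hx
      linarith [abs_nonneg (x - s)]
    have h1 := hG φ hφ (x - s) s hy hs
    have h2 := hG φ hφ (x - s) (x - s) hy hy
    rw [show s + (x - s) = x by ring] at h1
    rw [show x - s + (x - s) = 2 * x - 2 * s by ring] at h2
    rw [abs_le] at h1 h2 ⊢
    have h3 := neg_abs_le (φ (2 * x - 2 * s) - φ 0)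
    have h4 := le_abs_self (φ (2 * x - 2 * s) - φ 0)
    have h5 := neg_abs_le (φ s - φ 0)
    have h6 := le_abs_self (φ s - φ 0)
    constructor <;> linarith
  set D : ℝ := |A| + |A'| + 2 * C with hD
  refine ⟨2 * D, by positivity, fun φ hφ x hx => ?_⟩
  have hxR : |x| ≤ R := by rw [norm_rat_eq_abs] at hx; exact_mod_cast hx
  -- No a priori bound on `φ` is known, so maximize over the finite grid `(1/d)ℤ ∩ [-R, R]`. As `2 *
  -- s` is an integer multiple of `R`, the point `2x - 2s` stays on the grid, and `M ≤ M / 2 + D`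
  -- gives a bound independent of `d`.
  set d : ℤ := (x.den : ℤ) with hd'
  have hdpos : (0 : ℤ) < d := by simpa [hd'] using x.den_pos
  have hdq : (0 : ℚ) < d := by exact_mod_cast hdpos
  have mem_iff : ∀ m : ℤ, m ∈ Finset.Icc (-(R * d)) (R * d : ℤ) ↔ |(m / d : ℚ)| ≤ R := by
    intro m
    rw [Finset.mem_Icc, abs_le, le_div_iff₀ hdq, div_le_iff₀ hdq, neg_mul]
    norm_cast
  have hxm : (x.num / d : ℚ) = x := by simp [hd', Rat.num_div_den]
  have hxmem : x.num ∈ Finset.Icc (-(R * d)) (R * d : ℤ) := by rw [mem_iff, hxm]; exact hxR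
  obtain ⟨m, hm, hmax⟩ := Finset.exists_max_image (Finset.Icc (-(R * d)) (R * d : ℤ))
    (fun m : ℤ => |φ (m / d) - φ 0|) ⟨_, hxmem⟩
  have hmR := (mem_iff m).1 hm
  have hm' := abs_le.1 hmR
  have hR0 : (0 : ℚ) ≤ R := by positivity
  have fin : ∀ s : ℚ, ∀ e : ℤ, 2 * s = e * R → |s| ≤ R → |(2 * (m / d : ℚ) - 2 * s)| ≤ R →
      |φ s - φ 0| ≤ |A| + |A'| → |φ (m / d) - φ 0| ≤ 2 * D := by
    intro s e hse hs hy hB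
    have h1 := step φ hφ s _ hs hy
    have e1 : (2 * (m / d : ℚ) - 2 * s) = ((2 * m - e * R * d : ℤ) : ℚ) / d := by
      rw [hse]; push_cast; field_simp
    rw [e1] at h1 hy
    have h2 := hmax _ ((mem_iff _).2 hy)
    linarith
  have hmD : |φ (m / d) - φ 0| ≤ 2 * D := by
    have a1 := le_abs_self A
    have a2 := le_abs_self A'
    have a3 := abs_nonneg A
    have a4 := abs_nonneg A'
    have a5 := hA φ hφ
    have a6 := hA' φ hφ
    by_cases c1 : (m / d : ℚ) ≤ -(R / 2)
    · refine fin (-(R / 2)) (-1) (by push_cast; ring) ?_ ?_ (by linarith)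
      · rw [abs_le]; constructor <;> linarith
      · rw [abs_le]; constructor <;> linarith
    by_cases c2 : (m / d : ℚ) ≤ R / 2
    · refine fin 0 0 (by simp) (by simp) ?_ (by simp; positivity)
      rw [abs_le]; constructor <;> linarith
    · refine fin (R / 2) 1 (by push_cast; ring) ?_ ?_ (by linarith)
      · rw [abs_le]; constructor <;> linarith
      · rw [abs_le]; constructor <;> linarith
  have := hmax _ hxmem
  simp only [hxm] at this
  linarith

/-- Near 0, `φ (N * h) - φ 0` is almost `N * (φ h - φ 0)` yet bounded by `K`; dividing by a large
`N` makes `φ h - φ 0` small. Differences with step `y` carry this to other points. -/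
theorem EquiUniformOnBounded.of_diffSet {𝓕 : Set (ℚ → ℝ)}
    (hpb : ∀ r : ℚ, ∃ C, ∀ φ ∈ 𝓕, |φ r - φ 0| ≤ C)
    (hd : ∀ R, EquiUniformOnBounded (diffSet R 𝓕)) : EquiUniformOnBounded 𝓕 := by
  obtain ⟨K, hK, HK⟩ := exists_bound_of_diffSet hpb hd 1
  have small : ∀ ε > 0, ∃ δ > 0, ∀ φ ∈ 𝓕, ∀ h : ℚ, ‖h‖ ≤ δ → |φ h - φ 0| ≤ ε := by
    intro ε hε
    obtain ⟨δ, hδ, H⟩ := hd 1 1 (ε / 2) (by positivity)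
    obtain ⟨N, hN⟩ := exists_nat_gt (K / (ε / 2))
    have hN0 : (0 : ℝ) < N := lt_of_le_of_lt (by positivity) hN
    have hN1 : (1 : ℝ) ≤ N := by
      have : 0 < N := by exact_mod_cast hN0
      exact_mod_cast this
    refine ⟨min δ (1 / N), by positivity, fun φ hφ h hh => ?_⟩
    have hhδ := hh.trans (min_le_left _ _)
    have hhN := hh.trans (min_le_right _ _)
    rw [le_div_iff₀ hN0] at hhN
    have hb : ∀ j : ℕ, j ≤ N → ‖(j * h : ℚ)‖ ≤ 1 := by
      intro j hj
      have e1 : ‖(j : ℚ)‖ = j := by simp [norm_rat_eq_abs]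
      rw [norm_mul, e1]
      have : (j : ℝ) ≤ N := by exact_mod_cast hj
      nlinarith [norm_nonneg h]
    have key : ∀ j : ℕ, j ≤ N → |(φ (j * h) - φ 0) - j * (φ h - φ 0)| ≤ j * (ε / 2) := by
      intro j
      induction j with
      | zero => simp
      | succ j ih =>
        intro hj
        have h1 := ih (by omega)
        have h2 := H _ ⟨φ, hφ, j * h, hb j (by omega), rfl⟩ h 0 (by nlinarith [norm_nonneg h])
          (by simp) (by simpa using hhδ)
        simp only [zero_add] at h2
        rw [show h + j * h = ((j + 1 : ℕ) : ℚ) * h by push_cast; ring] at h2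
        rw [abs_le] at h1 h2 ⊢
        push_cast at *
        constructor <;> linarith
    have h1 := key N le_rfl
    have h2 := HK φ hφ (N * h) (by rw [Nat.cast_one]; exact hb N le_rfl)
    rw [div_lt_iff₀ (by positivity)] at hN
    have h3 : N * |φ h - φ 0| ≤ N * ε := by
      have : (N : ℝ) * |φ h - φ 0| = |N * (φ h - φ 0)| := by rw [abs_mul, Nat.abs_cast]
      rw [this]
      rw [abs_le] at h1 h2 ⊢
      constructor <;> linarith
    exact le_of_mul_le_mul_left h3 hN0
  intro R ε hε
  obtain ⟨δ, hδ, H⟩ := small (ε / 2) (by positivity)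
  obtain ⟨δ', hδ', H'⟩ := hd R 1 (ε / 2) (by positivity)
  refine ⟨min (min δ δ') 1, by positivity, fun φ hφ x y _ hy hxy => ?_⟩
  have h1 := H φ hφ (x - y) (hxy.trans ((min_le_left _ _).trans (min_le_left _ _)))
  have h2 := H' _ ⟨φ, hφ, y, hy, rfl⟩ (x - y) 0 (hxy.trans (min_le_right _ _)) (by simp)
    (by simpa using (hxy.trans ((min_le_left _ _).trans (min_le_right _ _))))
  simp only [sub_add_cancel, zero_add] at h2
  rw [abs_le] at h1 h2 ⊢
  constructor <;> linarith

/-- Pointwise boundedness rules out families such as linear functions of unbounded slope, whose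
differences are constant. -/
theorem EquiUniformOnBounded.of_iterate_diffSet (m : ℕ) : ∀ {𝓕 : Set (ℚ → ℝ)},
    (∀ r : ℚ, ∃ C, ∀ φ ∈ 𝓕, |φ r - φ 0| ≤ C) →
    (∀ R, EquiUniformOnBounded ((diffSet R)^[m] 𝓕)) → EquiUniformOnBounded 𝓕 := by
  induction m with
  | zero => exact fun _ h => h 0
  | succ m ih =>
    intro 𝓕 hpb hd
    have sub : ∀ R 𝓖, 𝓖 ⊆ diffSet R 𝓕 → ∀ R', EquiUniformOnBounded ((diffSet R')^[m] 𝓖) := by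
      intro R 𝓖 h𝓖 R'
      refine (hd (max R R')).mono ?_
      rw [Function.iterate_succ_apply]
      exact iterate_diffSet_mono (le_max_right _ _) m
        (h𝓖.trans (diffSet_mono (le_max_left _ _) subset_rfl))
    refine EquiUniformOnBounded.of_diffSet hpb fun R => ih (fun r => ?_) (sub R _ subset_rfl)
    -- The second difference is symmetric in point and step, so a bound for the fixed step `r` at
    -- all points `h` is a bound at the point `r` for all steps `h`.
    have hr : EquiUniformOnBounded {ψ : ℚ → ℝ | ∃ φ ∈ 𝓕, ψ = fun t => φ (t + r) - φ t} := by
      refine ih (fun s => ?_) (sub ‖r‖ _ ?_)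
      · obtain ⟨A, hA⟩ := hpb (s + r)
        obtain ⟨B, hB⟩ := hpb s
        obtain ⟨C, hC⟩ := hpb r
        refine ⟨A + B + C, ?_⟩
        rintro _ ⟨φ, hφ, rfl⟩
        have h1 := hA φ hφ
        have h2 := hB φ hφ
        have h3 := hC φ hφ
        simp only [zero_add]
        rw [abs_le] at h1 h2 h3 ⊢
        constructor <;> linarith
      · rintro _ ⟨φ, hφ, rfl⟩
        exact ⟨φ, hφ, r, le_rfl, rfl⟩
    obtain ⟨C, -, hC⟩ := hr.exists_bound R
    refine ⟨C, ?_⟩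
    rintro _ ⟨φ, hφ, h, hh, rfl⟩
    have := hC _ ⟨φ, hφ, rfl⟩ h hh
    simp only [zero_add] at this ⊢
    rw [add_comm h r] at this
    rw [abs_le] at this ⊢
    constructor <;> linarith

/-! ### Isolating a single ridge function -/

theorem EquiUniformOnBounded.shift_sub {E : Type*} [SeminormedAddCommGroup E] {𝓕 : Set (E → ℝ)}
    (h𝓕 : EquiUniformOnBounded 𝓕) (R : ℝ) :
    EquiUniformOnBounded {G : E → ℝ | ∃ F ∈ 𝓕, ∃ v : E, ‖v‖ ≤ R ∧ G = fun x => F (x + v) - F x} := by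
  intro S ε hε
  obtain ⟨δ, hδ, H⟩ := h𝓕 (max S (S + R)) (ε / 2) (by positivity)
  refine ⟨δ, hδ, ?_⟩
  rintro _ ⟨F, hF, v, hv, rfl⟩ x y hx hy hxy
  have h1 := H F hF (x + v) (y + v) (le_max_of_le_right ((norm_add_le _ _).trans (by linarith)))
    (le_max_of_le_right ((norm_add_le _ _).trans (by linarith))) (by simpa using hxy)
  have h2 := H F hF x y (le_max_of_le_left hx) (le_max_of_le_left hy) hxy
  rw [abs_le] at h1 h2 ⊢
  constructor <;> linarith

/-- A step `h • v` with `b l ⬝ᵥ v = 0` and `b i ⬝ᵥ v = 1` cancels ridge `l` and acts on ridge `i` as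
a step `h`. -/
theorem exists_family_killing_ridges {ι κ : Type*} [Fintype ι] [Fintype κ] [DecidableEq κ]
    {b : κ → ι → ℚ} {i : κ}
    (hb : ∀ j, j ≠ i → ∃ v : ι → ℚ, b j ⬝ᵥ v = 0 ∧ b i ⬝ᵥ v = 1)
    {f : (ι → ℚ) → ℝ} {φ : κ → ℚ → ℝ} (hf : ∀ x, f x = ∑ j, φ j (b j ⬝ᵥ x))
    (hfu : EquiUniformOnBounded {f}) (R : ℝ) (J : Finset κ) (hJ : i ∉ J) :
    ∃ 𝓚 : Set ((ι → ℚ) → ℝ), EquiUniformOnBounded 𝓚 ∧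
      ∀ ψ ∈ (diffSet R)^[J.card] {φ i}, ∃ F ∈ 𝓚, ∃ χ : κ → ℚ → ℝ,
        ∀ x, F x = ψ (b i ⬝ᵥ x) + ∑ j ∈ (insert i J)ᶜ, χ j (b j ⬝ᵥ x) := by
  induction J using Finset.induction_on with
  | empty =>
    refine ⟨{f}, hfu, ?_⟩
    rintro ψ rfl
    refine ⟨f, rfl, φ, fun x => ?_⟩
    rw [hf, ← Finset.add_sum_erase _ _ (Finset.mem_univ i)]
    congr 2
    ext j; simp
  | insert l J hl ih =>
    obtain ⟨𝓚, h𝓚, H⟩ := ih (fun h => hJ (Finset.mem_insert_of_mem h))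
    have hli : l ≠ i := by rintro rfl; exact hJ (Finset.mem_insert_self _ _)
    obtain ⟨v, hv0, hv1⟩ := hb l hli
    refine ⟨_, h𝓚.shift_sub (R * ‖v‖), ?_⟩
    rw [Finset.card_insert_of_notMem hl, Function.iterate_succ_apply']
    rintro _ ⟨ψ, hψ, h, hh, rfl⟩
    obtain ⟨F, hF, χ, hχ⟩ := H ψ hψ
    refine ⟨_, ⟨F, hF, h • v, ?_, rfl⟩, fun j t => χ j (t + h * (b j ⬝ᵥ v)) - χ j t, fun x => ?_⟩
    · rw [norm_smul]
      exact mul_le_mul_of_nonneg_right hh (norm_nonneg _)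
    · have hins : (insert i J)ᶜ = insert l (insert i (insert l J))ᶜ := by
        ext j
        by_cases hj : j = l
        · subst hj; simp [hli, hl]
        · simp [hj]
      simp only [hχ, hins]
      rw [Finset.sum_insert (by simp), Finset.sum_insert (by simp)]
      simp only [dotProduct_add, dotProduct_smul, hv0, hv1, smul_eq_mul, mul_zero, add_zero,
        mul_one, Finset.sum_sub_distrib]
      ring

theorem equiUniformOnBounded_ridge {ι κ : Type*} [Fintype ι] [Fintype κ] [DecidableEq κ]
    {b : κ → ι → ℚ} {i : κ} (hi : b i ≠ 0)
    (hb : ∀ j, j ≠ i → ∃ v : ι → ℚ, b j ⬝ᵥ v = 0 ∧ b i ⬝ᵥ v = 1)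
    {f : (ι → ℚ) → ℝ} {φ : κ → ℚ → ℝ} (hf : ∀ x, f x = ∑ j, φ j (b j ⬝ᵥ x))
    (hfu : EquiUniformOnBounded {f}) : EquiUniformOnBounded {φ i} := by
  refine EquiUniformOnBounded.of_iterate_diffSet ((Finset.univ.erase i).card)
    (fun r => ⟨|φ i r - φ i 0|, by rintro _ rfl; rfl⟩) fun R => ?_
  obtain ⟨𝓚, h𝓚, H⟩ := exists_family_killing_ridges hb hf hfu R (Finset.univ.erase i) (by simp)
  -- With no other ridge left, `F` restricted to the line `ℚ • w` is `ψ` itself.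
  set w : ι → ℚ := (b i ⬝ᵥ b i)⁻¹ • b i with hw
  have hbw : b i ⬝ᵥ w = 1 := by
    rw [hw, dotProduct_smul, smul_eq_mul, inv_mul_cancel₀]
    simpa [dotProduct_self_eq_zero] using hi
  have hw0 : 0 < ‖w‖ := by
    rw [norm_pos_iff]
    rintro h
    simp [h] at hbw
  intro S ε hε
  obtain ⟨δ, hδ, K⟩ := h𝓚 (S * ‖w‖) ε hε
  refine ⟨δ / ‖w‖, by positivity, fun ψ hψ x y hx hy hxy => ?_⟩
  obtain ⟨F, hF, χ, hχ⟩ := H ψ hψ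
  have e : ∀ t : ℚ, ψ t = F (t • w) := by
    intro t
    simp [hχ, dotProduct_smul, hbw]
  rw [e, e]
  refine K F hF _ _ ?_ ?_ ?_
  · rw [norm_smul]; gcongr
  · rw [norm_smul]; gcongr
  · rw [← sub_smul, norm_smul]
    rwa [le_div_iff₀ hw0] at hxy

/-! ### Passage from `ℚ` to `ℝ` -/

theorem exists_continuous_extension_of_rat {φ : ℚ → ℝ} (hφ : EquiUniformOnBounded {φ}) :
    ∃ g : ℝ → ℝ, Continuous g ∧ ∀ q : ℚ, g q = φ q := by
  have hcont : Continuous φ := by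
    rw [Metric.continuous_iff]
    intro x ε hε
    obtain ⟨δ, hδ, H⟩ := hφ (‖x‖ + 1) (ε / 2) (by positivity)
    refine ⟨min δ 1, by positivity, fun y hy => ?_⟩
    rw [dist_eq_norm] at hy
    rw [Real.dist_eq]
    have h1 := hy.le.trans (min_le_right _ _)
    have := H φ rfl y x (by linarith [norm_le_norm_add_norm_sub x y, norm_sub_rev x y])
      (by linarith) (hy.le.trans (min_le_left _ _))
    linarith
  have di := Rat.isDenseEmbedding_coe_real.isDenseInducing
  refine ⟨di.extend φ, di.continuous_extend fun r => ?_, fun q => di.extend_eq hcont q⟩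
  have : (Filter.comap ((↑) : ℚ → ℝ) (nhds r)).NeBot := di.comap_nhds_neBot r
  refine CompleteSpace.complete (f := Filter.map φ (Filter.comap ((↑) : ℚ → ℝ) (nhds r))) ?_
  rw [Metric.cauchy_iff]
  refine ⟨inferInstance, fun ε hε => ?_⟩
  obtain ⟨δ, hδ, H⟩ := hφ (|r| + 1) (ε / 2) (by positivity)
  set η := min (δ / 2) 1
  have hη : 0 < η := by positivity
  refine ⟨φ '' (((↑) : ℚ → ℝ) ⁻¹' Metric.ball r η),
    Filter.image_mem_map (Filter.preimage_mem_comap (Metric.ball_mem_nhds r hη)), ?_⟩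
  have hη1 : η ≤ δ / 2 := min_le_left _ _
  have hη2 : η ≤ 1 := min_le_right _ _
  rintro _ ⟨x, hx, rfl⟩ _ ⟨y, hy, rfl⟩
  simp only [Set.mem_preimage, Metric.mem_ball, Real.dist_eq] at hx hy
  rw [Real.dist_eq]
  have bd : ∀ z : ℚ, |(z : ℝ) - r| < η → ‖z‖ ≤ |r| + 1 := by
    intro z hz
    rw [norm_rat_eq_abs]
    have := abs_sub_abs_le_abs_sub (z : ℝ) r
    linarith
  have := H φ rfl x y (bd x hx) (bd y hy) (by
    rw [norm_rat_eq_abs]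
    push_cast
    have := abs_sub_le (x : ℝ) r y
    rw [abs_sub_comm r] at this
    linarith)
  linarith

theorem exists_rat_dual_vector {ι : Type*} [Fintype ι] {p q : ι → ℚ}
    (h : LinearIndependent ℚ ![p, q]) : ∃ v : ι → ℚ, q ⬝ᵥ v = 0 ∧ p ⬝ᵥ v = 1 := by
  set v : ι → ℚ := (q ⬝ᵥ q) • p - (p ⬝ᵥ q) • q with hv
  have hq : q ⬝ᵥ v = 0 := by
    rw [hv, dotProduct_sub, dotProduct_smul, dotProduct_smul, dotProduct_comm q p]
    simp only [smul_eq_mul]; ring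
  have hp : p ⬝ᵥ v ≠ 0 := by
    intro hp
    have hvv : v ⬝ᵥ v = 0 := by
      nth_rw 1 [hv]
      rw [sub_dotProduct, smul_dotProduct, smul_dotProduct, hp, hq]; simp
    have hv0 := dotProduct_self_eq_zero.1 hvv
    rw [hv, sub_eq_add_neg, ← neg_smul] at hv0
    have := (LinearIndependent.pair_iff.1 h _ _ hv0).1
    rw [dotProduct_self_eq_zero] at this
    have h1 := h.ne_zero 1
    exact h1 (by simpa using this)
  refine ⟨(p ⬝ᵥ v)⁻¹ • v, ?_, ?_⟩
  · rw [dotProduct_smul, hq, smul_zero]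
  · rw [dotProduct_smul, smul_eq_mul, inv_mul_cancel₀ hp]

theorem equiUniformOnBounded_of_continuous {n : ℕ} {f : (Fin n → ℝ) → ℝ} (hf : Continuous f) :
    EquiUniformOnBounded {fun x : Fin n → ℚ => f fun j => (x j : ℝ)} := by
  intro R ε hε
  have hu := (isCompact_closedBall (0 : Fin n → ℝ) R).uniformContinuousOn_of_continuous
    hf.continuousOn
  rw [Metric.uniformContinuousOn_iff] at hu
  obtain ⟨δ, hδ, H⟩ := hu ε hε
  refine ⟨δ / 2, by positivity, ?_⟩
  have hn : ∀ x : Fin n → ℚ, ‖(fun j => (x j : ℝ))‖ = ‖x‖ := fun x => by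
    simp [Pi.norm_def, nnnorm]
  rintro _ rfl x y hx hy hxy
  refine (H _ (by simpa [hn] using hx) _ (by simpa [hn] using hy) ?_).le
  rw [dist_eq_norm]
  have := hn (x - y)
  simp only [Pi.sub_apply, Rat.cast_sub] at this
  change ‖(fun j => (x j : ℝ) - (y j : ℝ))‖ < δ
  rw [this]; linarith

theorem exists_continuous_ridge_of_rat {n k : ℕ} (b : Fin k → Fin n → ℚ)
    (hb : Pairwise fun i j => LinearIndependent ℚ ![b i, b j])
    {f : (Fin n → ℝ) → ℝ} (hf : Continuous f) (φ : Fin k → ℝ → ℝ)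
    (hform : ∀ x, f x = ∑ i, φ i ((fun j => (b i j : ℝ)) ⬝ᵥ x)) :
    ∃ g : Fin k → ℝ → ℝ, (∀ i, Continuous (g i)) ∧
      ∀ x, f x = ∑ i, g i ((fun j => (b i j : ℝ)) ⬝ᵥ x) := by
  have hcast : ∀ i (x : Fin n → ℚ),
      (fun j => (b i j : ℝ)) ⬝ᵥ (fun j => (x j : ℝ)) = ((b i ⬝ᵥ x : ℚ) : ℝ) := by
    intro i x; simp [dotProduct]
  have hext : ∀ i, ∃ g : ℝ → ℝ, Continuous g ∧
      ∀ x : Fin n → ℚ, g ((b i ⬝ᵥ x : ℚ) : ℝ) = φ i ((b i ⬝ᵥ x : ℚ) : ℝ) := by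
    intro i
    -- A zero direction is still possible when `k = 1`.
    by_cases hi : b i = 0
    · exact ⟨fun _ => φ i 0, continuous_const, fun x => by simp [hi]⟩
    · obtain ⟨g, hg, hgφ⟩ := exists_continuous_extension_of_rat
        (equiUniformOnBounded_ridge (φ := fun i (q : ℚ) => φ i q) hi
          (fun j hj => exists_rat_dual_vector (hb hj.symm))
          (f := fun x : Fin n → ℚ => f fun j => (x j : ℝ))
          (fun x => by simp only [hform, hcast]) (equiUniformOnBounded_of_continuous hf))
      exact ⟨g, hg, fun x => hgφ _⟩
  choose g hg hgφ using hext
  refine ⟨g, hg, fun x => ?_⟩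
  have hdense : DenseRange (fun (x : Fin n → ℚ) j => (x j : ℝ)) :=
    DenseRange.piMap fun _ => Rat.denseRange_cast
  have hcg : Continuous fun x : Fin n → ℝ => ∑ i, g i ((fun j => (b i j : ℝ)) ⬝ᵥ x) :=
    continuous_finsetSum _ fun i _ => (hg i).comp (by fun_prop)
  refine congrFun (hdense.equalizer hf hcg ?_) x
  funext x
  simp only [Function.comp, hform, hcast, hgφ]

theorem corollary4p1 (n k : ℕ) (a : Fin k → (Fin n → ℝ))
    (ha : Pairwise fun i j => LinearIndependent ℝ ![a i, a j])
    (f : (Fin n → ℝ) → ℝ) (hf : Continuous f)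
    (hform : ∃ φ : Fin k → ℝ → ℝ, ∀ x, f x = ∑ i, φ i (dotProduct (a i) x))
    (hT : ∃ T : (Fin n → ℝ) ≃ₗ[ℝ] (Fin n → ℝ),
      ∀ i j, ∃ q : ℚ, T (a i) j = (q : ℝ)) :
    ∃ g : Fin k → ℝ → ℝ, (∀ i, Continuous (g i)) ∧
      ∀ x, f x = ∑ i, g i (dotProduct (a i) x) := by
  obtain ⟨φ, hφ⟩ := hform
  obtain ⟨T, hT⟩ := hT
  choose b hTb using hT
  have hb' : ∀ i, (fun j => (b i j : ℝ)) = T (a i) := fun i => funext fun j => (hTb i j).symm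
  have hb : Pairwise fun i j => LinearIndependent ℚ ![b i, b j] := by
    intro i j hij
    have h := LinearIndependent.pair_iff.1 (ha hij)
    rw [LinearIndependent.pair_iff]
    intro s t hst
    have := h s t (T.injective (by
      rw [map_add, map_smul, map_smul, ← hb', ← hb', map_zero]
      funext l
      have := congrFun hst l
      simp only [Pi.add_apply, Pi.smul_apply, smul_eq_mul, Pi.zero_apply] at this ⊢
      exact_mod_cast this))
    exact_mod_cast this
  set M := LinearMap.toMatrix' (T : (Fin n → ℝ) →ₗ[ℝ] (Fin n → ℝ)) with hM
  set M' := LinearMap.toMatrix' (T.symm : (Fin n → ℝ) →ₗ[ℝ] (Fin n → ℝ)) with hM'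
  have hMT : ∀ v, M.mulVec v = T v := fun v => by simp [hM, LinearMap.toMatrix'_mulVec]
  have hMT' : ∀ v, M'.mulVec v = T.symm v := fun v => by simp [hM', LinearMap.toMatrix'_mulVec]
  have hdot : ∀ (P : Matrix (Fin n) (Fin n) ℝ) (u y : Fin n → ℝ),
      u ⬝ᵥ P.transpose.mulVec y = P.mulVec u ⬝ᵥ y := fun P u y => by
    rw [Matrix.mulVec_transpose, dotProduct_comm, ← Matrix.dotProduct_mulVec, dotProduct_comm]
  -- Substituting `x = Mᵀ y` turns `a i ⬝ᵥ x` into `T (a i) ⬝ᵥ y`, whose direction is rational.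
  obtain ⟨g, hg, hgf⟩ := exists_continuous_ridge_of_rat b hb
    (f := fun y => f (M.transpose.mulVec y)) (hf.comp (by fun_prop)) φ
    (fun y => by simp only [hφ, hdot, hMT, hb'])
  refine ⟨g, hg, fun x => ?_⟩
  have hx : M.transpose.mulVec (M'.transpose.mulVec x) = x := by
    rw [Matrix.mulVec_mulVec, ← Matrix.transpose_mul, hM, hM', ← LinearMap.toMatrix'_comp]
    simp
  have := hgf (M'.transpose.mulVec x)
  simp only [hx] at this
  rw [this]
  simp only [hdot, hMT', hb', LinearEquiv.symm_apply_apply]
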